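/- Let $n\ge 1$ and $N\ge 0$ be integers. Let $\widehat D=\{x\in\mathbb R^n : x_i\ge -1,\ \sum_i x_i\le 2-n\}$ be the bi-unit right simplex, with barycentric coordinates $\lambda_i=(1+x_i)/2$ for $1\le i\le n$ and $\lambda_0=1-\lambda_1-\dots-\lambda_n$. For a multi-index $\alpha=(\alpha_0,\dots,\alpha_n)$ with $|\alpha|=N$ let $B^N_\alpha=\frac{N!}{\alpha_0!\cdots\alpha_n!}\lambda_0^{\alpha_0}\cdots\lambda_n^{\alpha_n}$ be the Bernstein polynomial of degree $N$. Fix a face $f$, $\{\lambda_f=0\}$, of $\widehat D$, with $0\le f\le n$. Define the mass matrix and the face mass matrix $$M_{\alpha\beta}=\int_{\widehat D}B^N_\beta B^N_\alpha,\qquad M^f_{\alpha\beta}=\int_{f}B^N_\beta B^N_\alpha,$$ where the face integral is taken with respect to the reference face: it is the Lebesgue integral over the bi-unit right simplex of dimension $n-1$, after pulling back by the affine parametrization of the face that keeps the order of the vertices. (This is the surface integral for the faces $x_k=-1$; for the slanted face $\lambda_0=0$ it is the surface integral divided by the constant surface Jacobian of the parametrization.) For $k\le m$ let $E^m_k$ be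 the degree elevation matrix on an $(n-1)$-dimensional simplex, which expresses the Bernstein polynomials of degree $k$ in those of degree $m$; that is, $E^m_k=E^m_{m-1}E^{m-1}_{m-2}\cdots E^{k+1}_k$, where $E^{j+1}_j$ is given by $B^j_\beta=\sum_i\frac{\beta_i+1}{j+1}B^{j+1}_{\beta+e_i}$, and $E^m_m=I$. Put $$\ell_i=(-1)^i\,\frac{\binom Ni}{1+i}\quad(0\le i\le N),\qquad L_0=\frac{(N+1)^2}{2}\,(E^{N+1}_N)^T E^{N+1}_N .$$ Then $M$ is invertible, and the columns of $M^{-1}M^f$ with index $\beta$, $\beta_f\neq 0$, are zero. Let $L^f$ be the face lift matrix, formed by the columns of $M^{-1}M^f$ with $\beta_f=0$ (the degrees of freedom of the face $f$, identified with the multi-indices of degree $N$ on the face), with the rows $\alpha$ ordered in layers parallel to $f$: the $i$-th layer, $0\le i\le N$, consists of the $\alpha$ with $\alpha_f=i$, identified with multi-indices of degree $N-i$ on the face by omitting $\alpha_f$. Then the block rows of $L^f$ are $$L^f_i=\ell_i\,(E^N_{N-i})^T L_0,\qquad 0\le i\le N,$$ in particular the first block row is $L_0$, and hence $$L^f=E_L^f\,L_0,\qquad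 E_L^f=\begin{pmatrix} I\\ \ell_1 (E^N_{N-1})^T\\ \vdots\\ \ell_N (E^N_0)^T\end{pmatrix}.$$ -/

import Mathlib

open MeasureTheory
open scoped Matrix

noncomputable section

namespace BernsteinBezier

/-- Multi-indices `α = (α_0, …, α_{m-1})` of natural numbers with `|α| = n`. They index the degree
`n` Bernstein polynomials on a simplex with `m` vertices, i.e. of dimension `m - 1`. -/
abbrev MultiIndex (m n : ℕ) : Type := {α : Fin m → ℕ // ∑ j, α j = n}

instance (m n : ℕ) : Fintype (MultiIndex m n) :=
  Fintype.subtype (Finset.Nat.antidiagonalTuple m n)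
    (fun _ => Finset.Nat.mem_antidiagonalTuple)

/-- The Bernstein polynomial `B^n_α(λ) = n! / (α_0! ⋯ α_{m-1}!) · λ_0^{α_0} ⋯ λ_{m-1}^{α_{m-1}}`
in barycentric coordinates `λ`. -/
def bern {m n : ℕ} (α : MultiIndex m n) (lam : Fin m → ℝ) : ℝ :=
  ((n.factorial : ℝ) / ∏ j, ((α.1 j).factorial : ℝ)) * ∏ j, lam j ^ α.1 j

/-- The bi-unit right simplex of dimension `d`:
all coordinates are at least `-1` and their sum is at most `2 - d`. -/
def refSimplex (d : ℕ) : Set (Fin d → ℝ) :=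
  {x | (∀ i, -1 ≤ x i) ∧ ∑ i, x i ≤ 2 - (d : ℝ)}

/-- Barycentric coordinates on the reference simplex: `λ_i = (1 + x_i) / 2` for `i ≥ 1` (the
Cartesian coordinates being numbered from `1`), and `λ_0 = 1 - λ_1 - ⋯ - λ_d`. -/
def bary {d : ℕ} (x : Fin d → ℝ) : Fin (d + 1) → ℝ :=
  Fin.cons (1 - ∑ i, (1 + x i) / 2) (fun i => (1 + x i) / 2)

/-- The point of the reference simplex with given barycentric coordinates. -/
def ofBary {d : ℕ} (lam : Fin (d + 1) → ℝ) : Fin d → ℝ := fun i => 2 * lam i.succ - 1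

/-- The affine parametrisation, by the `d`-dimensional reference simplex, of the face `λ_f = 0` of
the `(d+1)`-dimensional reference simplex: a zero barycentric coordinate is inserted at
position `f` and the other ones keep their order. -/
def faceParam {d : ℕ} (f : Fin (d + 2)) (y : Fin d → ℝ) : Fin (d + 1) → ℝ :=
  ofBary (f.insertNth (0 : ℝ) (bary y))

/-- The measure on the face `f` of the reference simplex: Lebesgue measure of the
`d`-dimensional reference simplex, carried over by the parametrisation of the face. For the faces
`x_k = -1` this is the surface measure (`faceParam_succ`); for the remaining face `λ_0 = 0` it is
the surface measure divided by the constant surface Jacobian of the parametrisation. -/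
def faceMeasure {d : ℕ} (f : Fin (d + 2)) : Measure (Fin (d + 1) → ℝ) :=
  (volume.restrict (refSimplex d)).map (faceParam f)

/-- The degree `N` Bernstein mass matrix `M_{αβ} = ∫ B^N_β B^N_α` over the reference simplex. -/
def massMatrix (d N : ℕ) : Matrix (MultiIndex (d + 1) N) (MultiIndex (d + 1) N) ℝ :=
  Matrix.of fun α β => ∫ x in refSimplex d, bern β (bary x) * bern α (bary x)

/-- The degree `N` face mass matrix `M^f_{αβ} = ∫_f B^N_β B^N_α`, over all the degrees of freedom
of the `(d+1)`-dimensional reference simplex. -/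
def faceMassMatrix {d : ℕ} (N : ℕ) (f : Fin (d + 2)) :
    Matrix (MultiIndex (d + 2) N) (MultiIndex (d + 2) N) ℝ :=
  Matrix.of fun α β => ∫ x, bern β (bary x) * bern α (bary x) ∂(faceMeasure f)

/-- One-degree elevation `E^{n+1}_n` on a simplex with `m` vertices: the column `β` has the entries
`(β_j + 1) / (n + 1)` in the rows `β + e_j`. -/
def oneElevation (m n : ℕ) : Matrix (MultiIndex m (n + 1)) (MultiIndex m n) ℝ :=
  Matrix.of fun α β =>
    ∑ j, if α.1 = β.1 + Pi.single j 1 then ((β.1 j : ℝ) + 1) / ((n : ℝ) + 1) else 0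

/-- Degree elevation `E^n_k = E^n_{n-1} E^{n-1}_{n-2} ⋯ E^{k+1}_k` for `k ≤ n`, on a simplex with
`m` vertices; `E^n_n` is the identity. (For `k > n` this is the zero matrix, which is not
used.) -/
def elevation (m : ℕ) : (n k : ℕ) → Matrix (MultiIndex m n) (MultiIndex m k) ℝ
  | 0, _ => Matrix.of fun α β => if α.1 = β.1 then 1 else 0
  | n + 1, k =>
    if k = n + 1 then Matrix.of fun α β => if α.1 = β.1 then 1 else 0
    else oneElevation m n * elevation m n k

/-- The multi-index with entry `i` at position `f` and the other entries given by `β`. -/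
def insertIndex {m N : ℕ} (f : Fin (m + 1)) (i : Fin (N + 1)) (β : MultiIndex m (N - i)) :
    MultiIndex (m + 1) N :=
  ⟨f.insertNth (i : ℕ) β.1, by
    rw [Fin.sum_univ_succAbove _ f]
    simp only [Fin.insertNth_apply_same, Fin.insertNth_apply_succAbove]
    rw [β.2]
    have := i.2
    omega⟩

theorem insertIndex_bijective {m N : ℕ} (f : Fin (m + 1)) :
    Function.Bijective
      (fun p : (Σ i : Fin (N + 1), MultiIndex m (N - i)) => insertIndex f p.1 p.2) := by
  constructor
  · rintro ⟨i, β⟩ ⟨j, γ⟩ h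
    have h' := congrArg Subtype.val h
    simp only [insertIndex] at h'
    have hi : (i : ℕ) = j := by simpa using congrFun h' f
    obtain rfl := Fin.ext hi
    have hb : β = γ := by
      apply Subtype.ext
      funext k
      simpa using congrFun h' (f.succAbove k)
    rw [hb]
  · intro α
    have hs := α.2
    rw [Fin.sum_univ_succAbove _ f] at hs
    refine ⟨⟨⟨α.1 f, by omega⟩, ⟨fun k => α.1 (f.succAbove k), ?_⟩⟩, ?_⟩
    · dsimp only
      omega
    · apply Subtype.ext
      exact Fin.insertNth_self_removeNth f α.1

/-- The ordering of the degrees of freedom in layers parallel to the face `λ_f = 0`: the `i`-th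
layer consists of the multi-indices `α` with `α_f = i`, and is indexed by the multi-indices of
degree `N - i` on the face. -/
def layers {m : ℕ} (N : ℕ) (f : Fin (m + 1)) :
    (Σ i : Fin (N + 1), MultiIndex m (N - i)) ≃ MultiIndex (m + 1) N :=
  Equiv.ofBijective _ (insertIndex_bijective f)

/-- The degrees of freedom associated with the face `λ_f = 0`, i.e. those with `α_f = 0`. -/
def faceIndex {m : ℕ} (N : ℕ) (f : Fin (m + 1)) (β : MultiIndex m N) : MultiIndex (m + 1) N :=
  insertIndex f 0 β

/-- The lift matrix `M⁻¹ M^f` over all the degrees of freedom of the simplex. -/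
def fullLift {d : ℕ} (N : ℕ) (f : Fin (d + 2)) :
    Matrix (MultiIndex (d + 2) N) (MultiIndex (d + 2) N) ℝ :=
  (massMatrix (d + 1) N)⁻¹ * faceMassMatrix N f

/-- The face lift matrix `L^f`: the columns of `M⁻¹ M^f` associated with the face `f`, with the
rows ordered in layers parallel to `f`. -/
def lift {d : ℕ} (N : ℕ) (f : Fin (d + 2)) :
    Matrix (Σ i : Fin (N + 1), MultiIndex (d + 1) (N - i)) (MultiIndex (d + 1) N) ℝ :=
  (fullLift N f).submatrix (layers N f) (faceIndex N f)

/-- The `i`-th block row `L_i` of the face lift matrix `L^f`. -/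
def liftBlock {d : ℕ} (N : ℕ) (f : Fin (d + 2)) (i : Fin (N + 1)) :
    Matrix (MultiIndex (d + 1) (N - i)) (MultiIndex (d + 1) N) ℝ :=
  (lift N f).submatrix (fun β => ⟨i, β⟩) id

/-- `L_0 = (N+1)² / 2 · (E^{N+1}_N)ᵀ E^{N+1}_N`, on a face with `m` vertices. -/
def L0 (m N : ℕ) : Matrix (MultiIndex m N) (MultiIndex m N) ℝ :=
  (((N : ℝ) + 1) ^ 2 / 2) • ((elevation m (N + 1) N)ᵀ * elevation m (N + 1) N)

/-- `ℓ_i = (-1)^i binom(N, i) / (1 + i)`. -/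
def ell (N i : ℕ) : ℝ := (-1) ^ i * (N.choose i : ℝ) / (1 + (i : ℝ))

/-- The face reduction matrix `E_L^f`, with block rows `ℓ_i (E^N_{N-i})ᵀ`, `0 ≤ i ≤ N`. -/
def faceReduction (m N : ℕ) :
    Matrix (Σ i : Fin (N + 1), MultiIndex m (N - i)) (MultiIndex m N) ℝ :=
  Matrix.of fun p γ => (ell N p.1 • (elevation m N (N - p.1))ᵀ) p.2 γ

/-! Checks that the definitions above are the intended ones. -/

theorem sum_bary {d : ℕ} (x : Fin d → ℝ) : ∑ j, bary x j = 1 := by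
  simp [bary, Fin.sum_univ_succ]

theorem bary_ofBary {d : ℕ} (lam : Fin (d + 1) → ℝ) (h : ∑ j, lam j = 1) :
    bary (ofBary lam) = lam := by
  rw [Fin.sum_univ_succ] at h
  funext j
  refine Fin.cases ?_ (fun i => ?_) j
  · simp only [bary, ofBary, Fin.cons_zero]
    have : ∑ i : Fin d, (1 + (2 * lam i.succ - 1)) / 2 = ∑ i : Fin d, lam i.succ :=
      Finset.sum_congr rfl (fun i _ => by ring)
    rw [this]
    linarith
  · simp only [bary, ofBary, Fin.cons_succ]
    ring

theorem bary_faceParam {d : ℕ} (f : Fin (d + 2)) (y : Fin d → ℝ) :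
    bary (faceParam f y) = f.insertNth (0 : ℝ) (bary y) := by
  apply bary_ofBary
  rw [Fin.sum_univ_succAbove _ f]
  simp [sum_bary]

theorem faceParam_succ {d : ℕ} (k : Fin (d + 1)) (y : Fin d → ℝ) :
    faceParam k.succ y = k.insertNth (-1 : ℝ) y := by
  funext i
  refine Fin.succAboveCases k ?_ (fun j => ?_) i
  · simp [faceParam, ofBary]
  · have : (k.succAbove j).succ = k.succ.succAbove j.succ := (Fin.succ_succAbove_succ k j).symm
    simp only [faceParam, ofBary, Fin.insertNth_apply_succAbove, this, bary, Fin.cons_succ]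
    ring

theorem measurable_faceParam {d : ℕ} (f : Fin (d + 2)) :
    Measurable (faceParam f : (Fin d → ℝ) → Fin (d + 1) → ℝ) := by
  refine measurable_pi_lambda _ (fun i => ?_)
  unfold faceParam ofBary
  refine Measurable.sub_const (Measurable.const_mul ?_ _) _
  generalize i.succ = j
  refine Fin.succAboveCases f ?_ (fun j => ?_) j
  · simp
  · simp only [Fin.insertNth_apply_succAbove]
    refine Fin.cases ?_ (fun k => ?_) j
    · simp only [bary, Fin.cons_zero]
      fun_prop
    · simp only [bary, Fin.cons_succ]
      fun_prop

theorem elevation_self (m n : ℕ) : elevation m n n = 1 := by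
  cases n with
  | zero =>
    ext α β
    simp [elevation, Matrix.one_apply, Subtype.ext_iff]
  | succ n =>
    ext α β
    simp [elevation, Matrix.one_apply, Subtype.ext_iff]

theorem bern_add_single {m n : ℕ} (β : MultiIndex m n) (j : Fin m) (α : MultiIndex m (n + 1))
    (hα : α.1 = β.1 + Pi.single j 1) (lam : Fin m → ℝ) :
    (((β.1 j : ℝ) + 1) / ((n : ℝ) + 1)) * bern α lam = lam j * bern β lam := by
  have h1 : ∀ i ∈ Finset.univ.erase j, α.1 i = β.1 i := by
    intro i hi
    simp [hα, (Finset.mem_erase.mp hi).1]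
  have h2 : α.1 j = β.1 j + 1 := by simp [hα]
  unfold bern
  rw [← Finset.mul_prod_erase Finset.univ _ (Finset.mem_univ j),
    ← Finset.mul_prod_erase Finset.univ (fun i => lam i ^ α.1 i) (Finset.mem_univ j),
    ← Finset.mul_prod_erase Finset.univ (fun i => ((β.1 i).factorial : ℝ)) (Finset.mem_univ j),
    ← Finset.mul_prod_erase Finset.univ (fun i => lam i ^ β.1 i) (Finset.mem_univ j),
    Finset.prod_congr rfl (fun i hi => by rw [h1 i hi] :
      ∀ i ∈ Finset.univ.erase j, ((α.1 i).factorial : ℝ) = ((β.1 i).factorial : ℝ)),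
    Finset.prod_congr rfl (fun i hi => by rw [h1 i hi] :
      ∀ i ∈ Finset.univ.erase j, lam i ^ α.1 i = lam i ^ β.1 i), h2]
  have h3 : (∏ i ∈ Finset.univ.erase j, ((β.1 i).factorial : ℝ)) ≠ 0 :=
    Finset.prod_ne_zero_iff.mpr (fun i _ => by positivity)
  have h4 : ((β.1 j).factorial : ℝ) ≠ 0 := by positivity
  have h5 : (n : ℝ) + 1 ≠ 0 := by positivity
  have h6 : (β.1 j : ℝ) + 1 ≠ 0 := by positivity
  rw [Nat.factorial_succ, Nat.factorial_succ]
  push_cast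
  field_simp
  ring

theorem bern_oneElevation {m n : ℕ} (β : MultiIndex m n) (lam : Fin m → ℝ)
    (h : ∑ j, lam j = 1) : bern β lam = ∑ α, oneElevation m n α β * bern α lam := by
  simp only [oneElevation, Matrix.of_apply, Finset.sum_mul]
  rw [Finset.sum_comm]
  calc bern β lam = ∑ j, lam j * bern β lam := by rw [← Finset.sum_mul, h, one_mul]
    _ = _ := Finset.sum_congr rfl (fun j _ => ?_)
  let α₀ : MultiIndex m (n + 1) :=
    ⟨β.1 + Pi.single j 1, by simp [Finset.sum_add_distrib, β.2]⟩
  rw [Finset.sum_eq_single α₀]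
  · rw [if_pos rfl, bern_add_single β j α₀ rfl]
  · intro α _ hα
    rw [if_neg (fun h' => hα (Subtype.ext h')), zero_mul]
  · intro h'
    exact absurd (Finset.mem_univ _) h'

/-- The degree elevation matrix expresses polynomials of degree `k` in the degree `n` basis. -/
theorem bern_elevation {m n k : ℕ} (hk : k ≤ n) (β : MultiIndex m k) (lam : Fin m → ℝ)
    (h : ∑ j, lam j = 1) : bern β lam = ∑ α, elevation m n k α β * bern α lam := by
  induction n with
  | zero =>
    obtain rfl : k = 0 := by omega
    simp [elevation_self, Matrix.one_apply]
  | succ n ih =>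
    by_cases hkn : k = n + 1
    · subst hkn
      simp [elevation_self, Matrix.one_apply]
    · rw [ih (by omega)]
      simp only [elevation, if_neg hkn, Matrix.mul_apply, Finset.sum_mul]
      rw [Finset.sum_comm]
      refine Finset.sum_congr rfl (fun γ _ => ?_)
      rw [bern_oneElevation γ lam h, Finset.mul_sum]
      exact Finset.sum_congr rfl (fun α _ => by ring)

end BernsteinBezier

end

/-! Since M is invertible, it suffices to check M (E_L^f L_0) = M^f on the face columns. The
Dirichlet integral makes both mass matrices constant multiples of `gram`, which factors over layers
as binom(k+i, k) times `gram` on the face. Summing a function of multi-indices against a row of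
E^N_{N-i} applies `lower` i times, up to (N-i)!/N!, and summing against L_0 applies `raise ∘ lower`
/ 2. The claim becomes an identity for ∑_i (-1)^i binom(k+i, k)/(i+1)! · raise (lower^{i+1} (gram
α)) at β, with |β| = N and |α| = N-k (`sum_raise_lower_gram`): it vanishes in the layers k > 0 and
is a multiple of `gram α β` for k = 0.

Two facts give this identity. The commutator of `raise` and `lower` is diagonal and `gram α` is an
eigenfunction of `raise` in each degree, so `raise` can be eliminated (`raise_lower_iterate_gram`).
And `lower` acts as -d/dX on F = ∏_j `binomPoly (α j) (β j)`, so the iterates of `lower` are, up to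
sign and p!, the coefficients of F (`lower_iterate_gram`). The sum then telescopes for k = 0; for k
> 0 it reduces to ∑_p binom(k-1+p, k-1) F_p, which vanishes because (1-X)^k divides F. -/

noncomputable section

namespace BernsteinBezier

/-! ### Raising and lowering operators on functions of multi-indices -/

open Polynomial in
/-- The polynomial `∑_j C(g,j) C(a,j) (1 - X)^(g-j)`. -/
def binomPoly (a g : ℕ) : ℝ[X] :=
  ∑ j ∈ Finset.range (g + 1), ((g.choose j : ℝ[X]) * (a.choose j : ℝ[X])) * (1 - X) ^ (g - j)

/-- Transposed differentiation on functions of multi-indices. -/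
def lower {m : ℕ} (g : (Fin m → ℕ) → ℝ) : (Fin m → ℕ) → ℝ :=
  fun γ => ∑ j, (γ j : ℝ) * g (γ - Pi.single j 1)

/-- Transposed degree raising on functions of multi-indices. -/
def raise {m : ℕ} (g : (Fin m → ℕ) → ℝ) : (Fin m → ℕ) → ℝ :=
  fun γ => ∑ j, ((γ j : ℝ) + 1) * g (γ + Pi.single j 1)

/-- The product of binomial coefficients `∏_j C(α_j + γ_j, α_j)`. -/
def gram {m : ℕ} (α γ : Fin m → ℕ) : ℝ := ∏ j, ((α j + γ j).choose (α j) : ℝ)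

theorem lower_apply {m : ℕ} (g : (Fin m → ℕ) → ℝ) (γ : Fin m → ℕ) :
    lower g γ = ∑ j, (γ j : ℝ) * g (γ - Pi.single j 1) := rfl

theorem sum_sub_single {m : ℕ} (γ : Fin m → ℕ) (j : Fin m) (h : γ j ≠ 0) :
    ((∑ i, (γ - Pi.single j 1 : Fin m → ℕ) i : ℕ) : ℝ) = ((∑ i, γ i : ℕ) : ℝ) - 1 := by
  have h1 : ∑ i, γ i = ∑ i, (γ - Pi.single j 1 : Fin m → ℕ) i + 1 := by
    have : γ = (γ - Pi.single j 1 : Fin m → ℕ) + Pi.single j 1 := by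
      funext i
      by_cases hi : i = j
      · subst hi; simp; omega
      · simp [hi]
    calc ∑ i, γ i = ∑ i, ((γ - Pi.single j 1 : Fin m → ℕ) + Pi.single j 1 : Fin m → ℕ) i := by
          rw [← this]
      _ = _ := by simp only [Pi.add_apply, Finset.sum_add_distrib]; simp
  rw [h1]; push_cast; ring

/-- Shifts in different directions commute; in direction j the two orders differ by (γ_j+1)² - γ_j²
= 2γ_j + 1. -/
theorem raise_lower {m : ℕ} (g : (Fin m → ℕ) → ℝ) (γ : Fin m → ℕ) :
    raise (lower g) γ = lower (raise g) γ + (2 * ((∑ i, γ i : ℕ) : ℝ) + m) * g γ := by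
  have key : ∀ j l : Fin m,
      ((γ j : ℝ) + 1) * (((γ + Pi.single j 1 : Fin m → ℕ) l : ℝ) *
        g (γ + Pi.single j 1 - Pi.single l 1)) =
      (γ l : ℝ) * ((((γ - Pi.single l 1 : Fin m → ℕ) j : ℝ) + 1) *
        g (γ - Pi.single l 1 + Pi.single j 1)) +
      if j = l then (2 * (γ j : ℝ) + 1) * g γ else 0 := by
    intro j l
    by_cases h : j = l
    · subst h
      rw [if_pos rfl, add_tsub_cancel_right]
      -- The subtraction in `γ - Pi.single j 1` is truncated, but where it truncates the weight γ_j
      -- is zero.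
      by_cases h0 : γ j = 0
      · simp [h0]
      · have h1 : γ - Pi.single j 1 + Pi.single j 1 = γ := by
          funext i
          by_cases hi : i = j
          · subst hi; simp; omega
          · simp [hi]
        rw [h1]
        obtain ⟨n, hn⟩ := Nat.exists_eq_succ_of_ne_zero h0
        simp [hn]
        ring
    · rw [if_neg h]
      have h1 : γ + Pi.single j 1 - Pi.single l 1 = γ - Pi.single l 1 + Pi.single j 1 := by
        funext i
        by_cases hi : i = j
        · subst hi; simp [h]
        · simp [hi]
      rw [h1]
      simp [h, Ne.symm h]
      ring
  unfold raise lower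
  simp only [Finset.mul_sum]
  rw [Finset.sum_comm (f := fun l j => (γ l : ℝ) * _)]
  simp only [key, Finset.sum_add_distrib]
  simp [Finset.sum_add_distrib, ← Finset.sum_mul, Finset.mul_sum]

/-- In each factor, (γ_j+1) binom(α_j+γ_j+1, α_j) = (α_j+γ_j+1) binom(α_j+γ_j, α_j). The eigenvalue
depends on γ only through |γ|. -/
theorem raise_gram {m : ℕ} (α γ : Fin m → ℕ) :
    raise (gram α) γ =
      (((∑ i, α i : ℕ) : ℝ) + m + ((∑ i, γ i : ℕ) : ℝ)) * gram α γ := by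
  have key : ∀ j, ((γ j : ℝ) + 1) * gram α (γ + Pi.single j 1) =
      ((α j : ℝ) + γ j + 1) * gram α γ := by
    intro j
    unfold gram
    rw [← Finset.mul_prod_erase Finset.univ _ (Finset.mem_univ j),
      ← Finset.mul_prod_erase Finset.univ (fun i => ((α i + γ i).choose (α i) : ℝ))
        (Finset.mem_univ j),
      Finset.prod_congr rfl (fun i hi => by simp [(Finset.mem_erase.mp hi).1] :
      ∀ i ∈ Finset.univ.erase j, ((α i + (γ + Pi.single j 1 : Fin m → ℕ) i).choose (α i) : ℝ) =
        ((α i + γ i).choose (α i) : ℝ)), ← mul_assoc, ← mul_assoc]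
    congr 1
    have := Nat.choose_mul_succ_eq (α j + γ j) (α j)
    have e : α j + γ j + 1 - α j = γ j + 1 := by omega
    rw [e] at this
    have h2 : ((α j + γ j).choose (α j) : ℝ) * (α j + γ j + 1) =
      ((α j + γ j + 1).choose (α j) : ℝ) * (γ j + 1) := by exact_mod_cast this
    simp only [Pi.add_apply, Pi.single_eq_same, ← add_assoc]
    linarith
  unfold raise
  simp only [key, ← Finset.sum_mul, Finset.sum_add_distrib]
  congr 1
  push_cast
  simp
  ring

/-- Moving `raise` past one `lower` at a time collects the commutators until `raise` meets `gram α`.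
Each `lower` evaluates its argument at degree |γ| - 1, which shifts the coefficients. -/
theorem raise_lower_iterate_gram {m : ℕ} (α : Fin m → ℕ) (p : ℕ) (γ : Fin m → ℕ) :
    raise (lower^[p + 1] (gram α)) γ =
      (((∑ i, α i : ℕ) : ℝ) + m + ((∑ i, γ i : ℕ) : ℝ) - (p + 1)) * lower^[p + 1] (gram α) γ +
      (p + 1) * (2 * ((∑ i, γ i : ℕ) : ℝ) + m - p) * lower^[p] (gram α) γ := by
  induction p generalizing γ with
  | zero =>
    simp only [zero_add, Function.iterate_one, Function.iterate_zero, id]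
    rw [raise_lower]
    have : lower (raise (gram α)) γ = (((∑ i, α i : ℕ) : ℝ) + m + ((∑ i, γ i : ℕ) : ℝ) - 1) *
        lower (gram α) γ := by
      rw [lower_apply, lower_apply, Finset.mul_sum]
      refine Finset.sum_congr rfl fun j _ => ?_
      by_cases h : γ j = 0
      · simp [h]
      · rw [raise_gram, sum_sub_single γ j h]; ring
    rw [this]; push_cast; ring
  | succ p ih =>
    rw [Function.iterate_succ_apply', raise_lower]
    have : lower (raise (lower^[p + 1] (gram α))) γ =
        (((∑ i, α i : ℕ) : ℝ) + m + ((∑ i, γ i : ℕ) : ℝ) - (p + 2)) *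
          lower (lower^[p + 1] (gram α)) γ +
        (p + 1) * (2 * ((∑ i, γ i : ℕ) : ℝ) + m - p - 2) * lower (lower^[p] (gram α)) γ := by
      rw [lower_apply, lower_apply, lower_apply]
      rw [Finset.mul_sum, Finset.mul_sum, ← Finset.sum_add_distrib]
      refine Finset.sum_congr rfl fun j _ => ?_
      by_cases h : γ j = 0
      · simp [h]
      · have := ih (γ - Pi.single j 1)
        rw [sum_sub_single γ j h] at this
        rw [this]; ring
    rw [this, ← Function.iterate_succ_apply' lower p]
    push_cast
    ring

/-! ### The generating polynomial of the iterates of `lower` -/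

open Polynomial in
theorem derivative_binomPoly (a g : ℕ) :
    derivative (binomPoly a g) = -((g : ℝ[X]) * binomPoly a (g - 1)) := by
  cases g with
  | zero => simp [binomPoly]
  | succ g =>
    unfold binomPoly
    rw [Finset.sum_range_succ]
    simp only [derivative_add, derivative_sum, Nat.add_sub_cancel]
    simp only [derivative_mul, derivative_natCast, derivative_pow, derivative_sub, derivative_one,
      derivative_X, Finset.mul_sum]
    simp only [zero_mul, mul_zero, zero_add, zero_sub, Nat.sub_self, Nat.cast_zero, map_zero,
      add_zero]
    rw [← Finset.sum_neg_distrib]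
    refine Finset.sum_congr rfl fun j hj => ?_
    have hj' := Finset.mem_range.mp hj
    have h1 : (g.choose j) * (g + 1) = (g + 1).choose j * (g + 1 - j) :=
      Nat.choose_mul_succ_eq g j
    have h2 : (g.choose j : ℝ[X]) * ((g : ℝ[X]) + 1) =
        ((g + 1).choose j : ℝ[X]) * ((g + 1 - j : ℕ) : ℝ[X]) := by exact_mod_cast h1
    have h3 : g + 1 - j - 1 = g - j := by omega
    rw [h3]
    simp only [map_natCast]
    push_cast [] at h2 ⊢
    linear_combination (a.choose j : ℝ[X]) * (1 - X) ^ (g - j) * h2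

-- Vandermonde's identity.
open Polynomial in
theorem eval_zero_binomPoly (a g : ℕ) : (binomPoly a g).eval 0 = ((a + g).choose a : ℝ) := by
  unfold binomPoly
  simp only [eval_finsetSum, eval_mul, eval_natCast, eval_pow, eval_sub, eval_one, eval_X,
    sub_zero, one_pow, mul_one]
  have h := Nat.add_choose_eq a g g
  rw [Finset.Nat.sum_antidiagonal_eq_sum_range_succ_mk] at h
  rw [Nat.choose_symm_add, h]
  push_cast
  refine Finset.sum_congr rfl fun j hj => ?_
  rw [Nat.choose_symm (Nat.lt_succ_iff.mp (Finset.mem_range.mp hj))]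
  ring

open Polynomial in
theorem pow_dvd_binomPoly (a g : ℕ) : (1 - X : ℝ[X]) ^ (g - a) ∣ binomPoly a g := by
  refine Finset.dvd_sum fun j _ => ?_
  by_cases h : j ≤ a
  · exact Dvd.dvd.mul_left (pow_dvd_pow _ (by omega)) _
  · rw [Nat.choose_eq_zero_of_lt (not_le.mp h)]
    simp

open Polynomial in
theorem derivative_prod_binomPoly {m : ℕ} (α γ : Fin m → ℕ) :
    derivative (∏ j, binomPoly (α j) (γ j)) =
      -∑ j, (γ j : ℝ[X]) * ∏ i, binomPoly (α i) ((γ - Pi.single j 1 : Fin m → ℕ) i) := by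
  rw [Polynomial.derivative_prod_finset, ← Finset.sum_neg_distrib]
  refine Finset.sum_congr rfl fun j _ => ?_
  have e : ∏ i, binomPoly (α i) ((γ - Pi.single j 1 : Fin m → ℕ) i) =
      binomPoly (α j) (γ j - 1) * ∏ i ∈ Finset.univ.erase j, binomPoly (α i) (γ i) := by
    rw [← Finset.mul_prod_erase Finset.univ _ (Finset.mem_univ j)]
    congr 1
    · simp
    · exact Finset.prod_congr rfl fun i hi => by simp [(Finset.mem_erase.mp hi).1]
  rw [derivative_binomPoly, e]
  ring

-- The product of the `binomPoly` equals `gram α γ` at X = 0, and by the Leibniz rule `lower` in γ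
-- is -d/dX. So p applications give (-1)^p times the p-th derivative at 0.
open Polynomial in
theorem lower_iterate_gram {m : ℕ} (α : Fin m → ℕ) (p : ℕ) (γ : Fin m → ℕ) :
    lower^[p] (gram α) γ =
      (-1) ^ p * p.factorial * (∏ j, binomPoly (α j) (γ j)).coeff p := by
  induction p generalizing γ with
  | zero =>
    simp [coeff_zero_eq_eval_zero, eval_prod, eval_zero_binomPoly, gram]
  | succ p ih =>
    rw [Function.iterate_succ_apply']
    have h := congrArg (fun q => coeff q p) (derivative_prod_binomPoly α γ)
    simp only [coeff_derivative, coeff_neg, finsetSum_coeff] at h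
    have h' : ∀ j, ((γ j : ℝ[X]) *
        ∏ i, binomPoly (α i) ((γ - Pi.single j 1 : Fin m → ℕ) i)).coeff p =
        γ j * (∏ i, binomPoly (α i) ((γ - Pi.single j 1 : Fin m → ℕ) i)).coeff p := by
      intro j
      rw [← C_eq_natCast, coeff_C_mul]
    simp only [h'] at h
    rw [lower_apply]
    simp only [ih]
    rw [Nat.factorial_succ]
    push_cast
    have : ∑ j, (γ j : ℝ) * ((-1) ^ p * (p.factorial : ℝ) *
        (∏ i, binomPoly (α i) ((γ - Pi.single j 1 : Fin m → ℕ) i)).coeff p) =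
        (-1) ^ p * (p.factorial : ℝ) * ∑ j, (γ j : ℝ) *
        (∏ i, binomPoly (α i) ((γ - Pi.single j 1 : Fin m → ℕ) i)).coeff p := by
      rw [Finset.mul_sum]
      exact Finset.sum_congr rfl fun j _ => by ring
    rw [this]
    linear_combination (-1) ^ p * (p.factorial : ℝ) * h

open Polynomial in
theorem natDegree_binomPoly_le (a g : ℕ) : (binomPoly a g).natDegree ≤ g := by
  refine natDegree_sum_le_of_forall_le _ _ fun j _ => ?_
  rw [← Nat.cast_mul, ← C_eq_natCast]
  refine (natDegree_C_mul_le _ _).trans ?_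
  refine natDegree_pow_le.trans ?_
  have : (1 - X : ℝ[X]).natDegree ≤ 1 := (natDegree_sub_le _ _).trans (by simp)
  calc (g - j) * (1 - X : ℝ[X]).natDegree ≤ (g - j) * 1 := Nat.mul_le_mul_left _ this
    _ ≤ g := by omega

/-! ### The alternating sum over the layers -/

-- The sum is the k-th Hasse derivative of X^k F at 1, and X^k F vanishes there to order at least
-- k+1.
open Polynomial in
theorem sum_choose_mul_coeff_eq_zero (k n : ℕ) (F : ℝ[X]) (hn : F.natDegree < n)
    (hF : (1 - X : ℝ[X]) ^ (k + 1) ∣ F) :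
    ∑ p ∈ Finset.range n, ((k + p).choose k : ℝ) * F.coeff p = 0 := by
  obtain ⟨H, rfl⟩ := hF
  set F := (1 - X : ℝ[X]) ^ (k + 1) * H with hFdef
  have h1 : (taylor 1 (X ^ k * F)).coeff k = 0 := by
    have : taylor 1 (X ^ k * F) = X ^ (k + 1) * (taylor 1 (X ^ k * H) * (-1) ^ (k + 1)) := by
      rw [hFdef]
      simp only [taylor_mul, taylor_pow, map_sub, taylor_X, taylor_one]
      have : (C (1:ℝ) - (X + C 1)) = -X := by ring
      rw [this, neg_pow]
      ring
    rw [this, coeff_X_pow_mul', if_neg (by omega)]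
  rw [taylor_coeff, eval_eq_sum_range' (n := n)] at h1
  · simp only [hasseDeriv_coeff, one_pow, mul_one, coeff_X_pow_mul] at h1
    rw [← h1]
    refine Finset.sum_congr rfl fun p _ => ?_
    rw [add_comm k p]
  · refine lt_of_le_of_lt (natDegree_hasseDeriv_le _ _) ?_
    have := natDegree_mul_le (p := (X ^ k : ℝ[X])) (q := F)
    rw [natDegree_X_pow] at this
    omega

open Polynomial in
theorem sum_raise_lower_gram {m N k : ℕ} (α β : Fin m → ℕ) (hβ : ∑ j, β j = N)
    (hα : ∑ j, α j + k = N) :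
    ∑ i ∈ Finset.range (N + 1), (-1 : ℝ) ^ i * ((k + i).choose k : ℝ) / ((i + 1).factorial : ℝ) *
      raise (lower^[i + 1] (gram α)) β =
    if k = 0 then (2 * N + m) * gram α β else 0 := by
  set F : ℝ[X] := ∏ j, binomPoly (α j) (β j) with hF
  have hdeg : F.natDegree ≤ N := by
    rw [← hβ]
    exact (natDegree_prod_le _ _).trans (Finset.sum_le_sum fun j _ => natDegree_binomPoly_le _ _)
  have hαr : ((∑ i, α i : ℕ) : ℝ) = N - k := by
    rw [← hα]; push_cast; ring
  have hterm : ∀ i : ℕ, (-1 : ℝ) ^ i * ((k + i).choose k : ℝ) / ((i + 1).factorial : ℝ) *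
      raise (lower^[i + 1] (gram α)) β = ((k + i).choose k : ℝ) *
        ((2 * N + m - i) * F.coeff i - (2 * N + m - k - 1 - i) * F.coeff (i + 1)) := by
    intro i
    rw [raise_lower_iterate_gram, lower_iterate_gram, lower_iterate_gram, hαr, hβ, ← hF,
      Nat.factorial_succ]
    have h1 : (i.factorial : ℝ) ≠ 0 := by positivity
    have h2 : (i : ℝ) + 1 ≠ 0 := by positivity
    have h3 : ((-1 : ℝ) ^ i) * (-1) ^ i = 1 := by
      rw [← mul_pow]; norm_num
    push_cast
    field_simp
    rw [pow_succ]
    linear_combination (norm := ring_nf) ((k + i).choose k : ℝ) *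
        ((2 * N + m - i) * F.coeff i - (2 * N + m - k - 1 - i) * F.coeff (i + 1)) * h3
  rw [Finset.sum_congr rfl fun i _ => hterm i]
  have hlast : F.coeff (N + 1) = 0 := coeff_eq_zero_of_natDegree_lt (by omega)
  cases k with
  | zero =>
    -- With k = 0 all binomials are 1 and consecutive terms telescope.
    have h : ∀ n : ℕ, ∑ i ∈ Finset.range n, ((0 + i).choose 0 : ℝ) *
        ((2 * N + m - i) * F.coeff i - (2 * N + m - (0 : ℕ) - 1 - i) * F.coeff (i + 1)) =
        (2 * N + m) * F.coeff 0 - (2 * N + m - n) * F.coeff n := by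
      intro n
      induction n with
      | zero => simp
      | succ n ih => rw [Finset.sum_range_succ, ih]; simp only [Nat.choose_zero_right]; push_cast; ring
    rw [h, hlast, if_pos rfl, coeff_zero_eq_eval_zero, hF, eval_prod]
    simp [eval_zero_binomPoly, gram]
  | succ k =>
    -- Summation by parts: collecting the coefficient of F_i, Pascal's rule and (k+1) binom(k+i,
    -- k+1) = i binom(k+i, k) leave (2N+m) binom(k+i, k).
    have h : ∀ n : ℕ, ∑ i ∈ Finset.range n, ((k + 1 + i).choose (k + 1) : ℝ) *
        ((2 * N + m - i) * F.coeff i -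
          (2 * N + m - (k + 1 : ℕ) - 1 - i) * F.coeff (i + 1)) =
        (2 * N + m) * ∑ i ∈ Finset.range n, ((k + i).choose k : ℝ) * F.coeff i -
          ((k + n).choose (k + 1) : ℝ) * (2 * N + m - k - 1 - n) * F.coeff n := by
      intro n
      induction n with
      | zero => simp
      | succ n ih =>
        rw [Finset.sum_range_succ, ih, Finset.sum_range_succ]
        have e1 : k + 1 + n = k + n + 1 := by ring
        rw [e1, ← add_assoc k n 1, Nat.choose_succ_succ (k + n) k]
        have e2 : ((k + n).choose (k + 1) : ℝ) * (k + 1) = (k + n).choose k * n := by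
          have := Nat.choose_succ_right_eq (k + n) k
          rw [Nat.add_sub_cancel_left] at this
          exact_mod_cast this
        push_cast
        linear_combination F.coeff n * e2
    rw [h, hlast, sum_choose_mul_coeff_eq_zero k (N + 1) F (by omega), if_neg (by omega)]
    · ring
    · have h1 : (∏ j, (1 - X : ℝ[X]) ^ (β j - α j)) ∣ F :=
        Finset.prod_dvd_prod_of_dvd _ _ fun j _ => pow_dvd_binomPoly _ _
      rw [Finset.prod_pow_eq_pow_sum] at h1
      refine (pow_dvd_pow _ ?_).trans h1
      -- Truncated differences sum to at least |β| - |α|, the layer index, which is the required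
      -- order of vanishing at 1.
      have : ∑ j, β j ≤ ∑ j, (β j - α j) + ∑ j, α j := by
        rw [← Finset.sum_add_distrib]
        exact Finset.sum_le_sum fun j _ => by omega
      omega

/-! ### Dirichlet integrals and the entries of the mass matrices -/

theorem hasDerivAt_pow_mul_pow (s : ℝ) (a b : ℕ) (t : ℝ) :
    HasDerivAt (fun t : ℝ => ((1 + t) / 2) ^ a * (s - (1 + t) / 2) ^ b)
      (a * ((1 + t) / 2) ^ (a - 1) * (1 / 2) * (s - (1 + t) / 2) ^ b +
        ((1 + t) / 2) ^ a * (b * (s - (1 + t) / 2) ^ (b - 1) * (-(1 / 2)))) t := by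
  have h1 : HasDerivAt (fun t : ℝ => (1 + t) / 2) (1 / 2) t :=
    ((hasDerivAt_id t).const_add 1).div_const 2
  exact (h1.fun_pow a).mul ((h1.const_sub s).fun_pow b)

/-- A rescaled Beta integral; integration by parts trades one power of the second factor for one of
the first, with vanishing boundary terms. -/
theorem integral_pow_mul_pow (s : ℝ) (a b : ℕ) :
    ∫ t in (-1 : ℝ)..(2 * s - 1), ((1 + t) / 2) ^ a * (s - (1 + t) / 2) ^ b =
      2 * s ^ (a + b + 1) * (a.factorial * b.factorial / (a + b + 1).factorial) := by
  induction b generalizing a with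
  | zero =>
    have h : ∀ t : ℝ, HasDerivAt (fun t : ℝ => 2 / ((a : ℝ) + 1) *
        (((1 + t) / 2) ^ (a + 1) * (s - (1 + t) / 2) ^ 0))
        (((1 + t) / 2) ^ a * (s - (1 + t) / 2) ^ 0) t := by
      intro t
      have h2 : (a : ℝ) + 1 ≠ 0 := by positivity
      convert! (hasDerivAt_pow_mul_pow s (a + 1) 0 t).const_mul (2 / ((a : ℝ) + 1)) using 1
      simp
      field_simp
    rw [intervalIntegral.integral_eq_sub_of_hasDerivAt (fun t _ => h t)
      (Continuous.intervalIntegrable (by fun_prop) _ _), Nat.add_zero, Nat.factorial_succ]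
    have h1 : (a.factorial : ℝ) ≠ 0 := by positivity
    have h2 : (a : ℝ) + 1 ≠ 0 := by positivity
    push_cast
    field_simp
    ring
  | succ b ih =>
    have h : ∀ t : ℝ, HasDerivAt (fun t : ℝ =>
        ((1 + t) / 2) ^ (a + 1) * (s - (1 + t) / 2) ^ (b + 1))
        (((a : ℝ) + 1) / 2 * (((1 + t) / 2) ^ a * (s - (1 + t) / 2) ^ (b + 1)) -
          ((b : ℝ) + 1) / 2 * (((1 + t) / 2) ^ (a + 1) * (s - (1 + t) / 2) ^ b)) t := by
      intro t
      convert! hasDerivAt_pow_mul_pow s (a + 1) (b + 1) t using 1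
      simp
      ring
    have h' := intervalIntegral.integral_eq_sub_of_hasDerivAt (a := -1) (b := 2 * s - 1)
      (fun t _ => h t) (Continuous.intervalIntegrable (by fun_prop) _ _)
    rw [intervalIntegral.integral_sub (Continuous.intervalIntegrable (by fun_prop) _ _)
      (Continuous.intervalIntegrable (by fun_prop) _ _), intervalIntegral.integral_const_mul,
      intervalIntegral.integral_const_mul, ih] at h'
    have e : (1 + (2 * s - 1)) / 2 = s := by ring
    rw [e] at h'
    have e2 : a + 1 + b + 1 = a + (b + 1) + 1 := by ring
    rw [e2, Nat.factorial_succ a] at h'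
    have h2 : (a : ℝ) + 1 ≠ 0 := by positivity
    apply mul_left_cancel₀ h2
    rw [Nat.factorial_succ b]
    push_cast at h' ⊢
    simp at h'
    linear_combination 2 * h'

theorem lintegral_pow_mul_pow {s : ℝ} (hs : 0 ≤ s) (a b : ℕ) :
    ∫⁻ t in Set.Icc (-1 : ℝ) (2 * s - 1),
      ENNReal.ofReal (((1 + t) / 2) ^ a * (s - (1 + t) / 2) ^ b) =
      ENNReal.ofReal
        (2 * s ^ (a + b + 1) * (a.factorial * b.factorial / (a + b + 1).factorial)) := by
  rw [← integral_pow_mul_pow, intervalIntegral.integral_of_le (by linarith),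
    ← integral_Icc_eq_integral_Ioc, ofReal_integral_eq_lintegral_ofReal]
  · exact (Continuous.continuousOn (by fun_prop)).integrableOn_compact isCompact_Icc
  · filter_upwards [ae_restrict_mem measurableSet_Icc] with t ht
    have h1 : 0 ≤ (1 + t) / 2 := by linarith [ht.1]
    have h2 : 0 ≤ s - (1 + t) / 2 := by linarith [ht.2]
    simp only [Pi.zero_apply]
    positivity

/-- The bi-unit right simplex scaled by the factor `s` from its right-angled vertex. -/
def scaledSimplex (d : ℕ) (s : ℝ) : Set (Fin d → ℝ) :=
  {x | (∀ i, -1 ≤ x i) ∧ ∑ i, (1 + x i) / 2 ≤ s}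

theorem measurableSet_scaledSimplex (d : ℕ) (s : ℝ) : MeasurableSet (scaledSimplex d s) := by
  have h : scaledSimplex d s =
      (⋂ i, {x | -1 ≤ x i}) ∩ {x : Fin d → ℝ | ∑ i, (1 + x i) / 2 ≤ s} := by
    ext; simp [scaledSimplex]
  rw [h]
  refine (MeasurableSet.iInter fun i =>
    measurableSet_le measurable_const (measurable_pi_apply i)).inter
      (measurableSet_le ?_ measurable_const)
  fun_prop

theorem refSimplex_eq (d : ℕ) : refSimplex d = scaledSimplex d 1 := by
  ext x
  have : ∑ i, (1 + x i) / 2 = (d + ∑ i, x i) / 2 := by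
    rw [← Finset.sum_div, Finset.sum_add_distrib]; simp
  simp only [refSimplex, scaledSimplex, Set.mem_ofPred_eq, this]
  refine and_congr_right fun _ => ⟨fun h => by linarith, fun h => by linarith⟩

/-- Slicing by the first coordinate t leaves a simplex of scale s - (1+t)/2, hence the general s.
The lower integral allows Tonelli without integrability conditions. -/
theorem lintegral_scaledSimplex (d : ℕ) (a₀ : ℕ) (a : Fin d → ℕ) {s : ℝ} (hs : 0 ≤ s) :
    ∫⁻ x in scaledSimplex d s,
      ENNReal.ofReal ((s - ∑ i, (1 + x i) / 2) ^ a₀ * ∏ i, ((1 + x i) / 2) ^ a i) =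
    ENNReal.ofReal (2 ^ d * s ^ (a₀ + ∑ i, a i + d) *
      (a₀.factorial * (∏ i, ((a i).factorial : ℝ)) / (a₀ + ∑ i, a i + d).factorial)) := by
  induction d generalizing s with
  | zero =>
    have h : scaledSimplex 0 s = Set.univ := by ext; simp [scaledSimplex, hs]
    have h1 : (a₀.factorial : ℝ) ≠ 0 := by positivity
    rw [h, Measure.restrict_univ, lintegral_unique]
    simp [volume_pi, h1]
  | succ d ih =>
    rw [← lintegral_indicator (measurableSet_scaledSimplex _ _),
      ← ((volume_preserving_piFinSuccAbove (fun _ : Fin (d + 1) => ℝ) 0).symm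
        (MeasurableEquiv.piFinSuccAbove (fun _ : Fin (d + 1) => ℝ) 0)).lintegral_comp_emb
        (MeasurableEquiv.measurableEmbedding _), Measure.volume_eq_prod, lintegral_prod]
    swap
    · have hf : Measurable ((scaledSimplex (d + 1) s).indicator (fun x => ENNReal.ofReal
          ((s - ∑ i, (1 + x i) / 2) ^ a₀ * ∏ i, ((1 + x i) / 2) ^ a i))) :=
        Measurable.indicator (by fun_prop) (measurableSet_scaledSimplex _ _)
      exact (hf.comp (MeasurableEquiv.measurable _)).aemeasurable
    -- The power of the slice's scale produced by the inner integral; it becomes an exponent in the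
    -- remaining Beta integral.
    set b := a₀ + ∑ i, a (Fin.succ i) + d with hb
    have key : ∀ t : ℝ, ∫⁻ y : Fin d → ℝ, (scaledSimplex (d + 1) s).indicator
        (fun x => ENNReal.ofReal ((s - ∑ i, (1 + x i) / 2) ^ a₀ * ∏ i, ((1 + x i) / 2) ^ a i))
        ((MeasurableEquiv.piFinSuccAbove (fun _ : Fin (d + 1) => ℝ) 0).symm (t, y)) =
      (Set.Icc (-1 : ℝ) (2 * s - 1)).indicator (fun t =>
        ENNReal.ofReal (2 ^ d * (a₀.factorial * (∏ i : Fin d, ((a i.succ).factorial : ℝ)) / b.factorial)) *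
          ENNReal.ofReal (((1 + t) / 2) ^ a 0 * (s - (1 + t) / 2) ^ b)) t := by
      intro t
      have hcons : ∀ y : Fin d → ℝ,
        (MeasurableEquiv.piFinSuccAbove (fun _ : Fin (d + 1) => ℝ) 0).symm (t, y) =
          (Fin.cons t y : Fin (d + 1) → ℝ) := fun y => by
            simp [MeasurableEquiv.piFinSuccAbove, Fin.insertNthEquiv]
      by_cases ht : t ∈ Set.Icc (-1 : ℝ) (2 * s - 1)
      · have h1 : 0 ≤ (1 + t) / 2 := by linarith [ht.1]
        have h2 : 0 ≤ s - (1 + t) / 2 := by linarith [ht.2]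
        rw [Set.indicator_of_mem ht, ← ENNReal.ofReal_mul (by positivity)]
        have e : ∀ y : Fin d → ℝ, (scaledSimplex (d + 1) s).indicator
            (fun x => ENNReal.ofReal
              ((s - ∑ i, (1 + x i) / 2) ^ a₀ * ∏ i, ((1 + x i) / 2) ^ a i))
            (Fin.cons t y : Fin (d + 1) → ℝ) =
            ENNReal.ofReal (((1 + t) / 2) ^ a 0) *
            (scaledSimplex d (s - (1 + t) / 2)).indicator (fun y => ENNReal.ofReal
              ((s - (1 + t) / 2 - ∑ i, (1 + y i) / 2) ^ a₀ *
                ∏ i, ((1 + y i) / 2) ^ a i.succ)) y := by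
          intro y
          have hm : (Fin.cons t y : Fin (d + 1) → ℝ) ∈ scaledSimplex (d + 1) s ↔
              y ∈ scaledSimplex d (s - (1 + t) / 2) := by
            simp only [scaledSimplex, Set.mem_ofPred_eq, Fin.forall_fin_succ, Fin.sum_univ_succ,
              Fin.cons_zero, Fin.cons_succ]
            exact ⟨fun h => ⟨h.1.2, by linarith [h.2]⟩,
              fun h => ⟨⟨ht.1, h.1⟩, by linarith [h.2]⟩⟩
          by_cases hy : y ∈ scaledSimplex d (s - (1 + t) / 2)
          · rw [Set.indicator_of_mem (hm.2 hy), Set.indicator_of_mem hy,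
              ← ENNReal.ofReal_mul (by positivity)]
            simp only [Fin.sum_univ_succ, Fin.prod_univ_succ, Fin.cons_zero, Fin.cons_succ]
            congr 1
            rw [sub_sub]
            ring
          · rw [Set.indicator_of_notMem (mt hm.1 hy), Set.indicator_of_notMem hy, mul_zero]
        simp only [hcons, e]
        rw [lintegral_const_mul' _ _ ENNReal.ofReal_ne_top,
          lintegral_indicator (measurableSet_scaledSimplex _ _), ih _ h2,
          ← ENNReal.ofReal_mul (by positivity)]
        congr 1
        ring
      · rw [Set.indicator_of_notMem ht]
        refine (lintegral_congr fun y => ?_).trans lintegral_zero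
        rw [hcons]
        refine Set.indicator_of_notMem (fun hy => ht ?_) _
        simp only [scaledSimplex, Set.mem_ofPred_eq, Fin.forall_fin_succ, Fin.sum_univ_succ,
          Fin.cons_zero, Fin.cons_succ] at hy
        have : 0 ≤ ∑ i, (1 + y i) / 2 :=
          Finset.sum_nonneg fun i _ => by linarith [hy.1.2 i]
        exact ⟨hy.1.1, by linarith [hy.2]⟩
    simp only [key]
    rw [lintegral_indicator measurableSet_Icc, lintegral_const_mul' _ _ ENNReal.ofReal_ne_top,
      lintegral_pow_mul_pow hs, ← ENNReal.ofReal_mul (by positivity), Fin.sum_univ_succ,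
      Fin.prod_univ_succ]
    congr 1
    rw [show a₀ + (a 0 + ∑ i : Fin d, a i.succ) + (d + 1) = a 0 + b + 1 by omega]
    have h1 : (b.factorial : ℝ) ≠ 0 := by positivity
    rw [pow_succ 2 d]
    field_simp

theorem integral_prod_bary_pow (d : ℕ) (a : Fin (d + 1) → ℕ) :
    ∫ x in refSimplex d, ∏ j, bary x j ^ a j =
      2 ^ d * ((∏ j, ((a j).factorial : ℝ)) / (∑ j, a j + d).factorial) := by
  have hprod : ∀ x : Fin d → ℝ, ∏ j, bary x j ^ a j =
      (1 - ∑ i, (1 + x i) / 2) ^ a 0 * ∏ i, ((1 + x i) / 2) ^ a (Fin.succ i) := by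
    intro x
    simp [Fin.prod_univ_succ, bary]
  simp only [hprod]
  rw [refSimplex_eq, integral_eq_lintegral_of_nonneg_ae,
    lintegral_scaledSimplex d (a 0) (fun i => a i.succ) zero_le_one,
    ENNReal.toReal_ofReal (by positivity), Fin.prod_univ_succ, Fin.sum_univ_succ]
  · simp
  · filter_upwards [ae_restrict_mem (measurableSet_scaledSimplex d 1)] with x hx
    have h1 : 0 ≤ 1 - ∑ i, (1 + x i) / 2 := by linarith [hx.2]
    have h2 : ∀ i, 0 ≤ (1 + x i) / 2 := fun i => by linarith [hx.1 i]
    exact mul_nonneg (pow_nonneg h1 _) (Finset.prod_nonneg fun i _ => pow_nonneg (h2 i) _)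
  · exact Measurable.aestronglyMeasurable (by fun_prop)

theorem integral_bern_mul_bern (d : ℕ) {n : ℕ} (α β : MultiIndex (d + 1) n) :
    ∫ x in refSimplex d, bern β (bary x) * bern α (bary x) =
      2 ^ d * (n.factorial : ℝ) ^ 2 / (2 * n + d).factorial * gram α.1 β.1 := by
  have h : ∀ x : Fin d → ℝ, bern β (bary x) * bern α (bary x) =
      ((n.factorial : ℝ) / ∏ j, ((β.1 j).factorial : ℝ)) *
      ((n.factorial : ℝ) / ∏ j, ((α.1 j).factorial : ℝ)) *
        ∏ j, bary x j ^ (α.1 + β.1) j := by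
    intro x
    unfold bern
    simp only [Pi.add_apply, pow_add, Finset.prod_mul_distrib]
    ring
  simp only [h]
  rw [integral_const_mul, integral_prod_bary_pow]
  have hs : ∑ j, (α.1 + β.1) j = 2 * n := by
    simp only [Pi.add_apply, Finset.sum_add_distrib, α.2, β.2]; ring
  have hg : gram α.1 β.1 = (∏ j, (((α.1 + β.1) j).factorial : ℝ)) /
      ((∏ j, ((α.1 j).factorial : ℝ)) * ∏ j, ((β.1 j).factorial : ℝ)) := by
    unfold gram
    rw [← Finset.prod_mul_distrib, ← Finset.prod_div_distrib]
    refine Finset.prod_congr rfl fun j _ => ?_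
    rw [Nat.cast_add_choose]
    rfl
  rw [hs, hg]
  ring

theorem massMatrix_apply (d N : ℕ) (α β : MultiIndex (d + 1) N) :
    massMatrix d N α β =
      2 ^ d * (N.factorial : ℝ) ^ 2 / (2 * N + d).factorial * gram α.1 β.1 :=
  integral_bern_mul_bern d α β

theorem continuous_bary {d : ℕ} : Continuous (bary : (Fin d → ℝ) → Fin (d + 1) → ℝ) := by
  refine continuous_pi fun j => ?_
  refine Fin.cases ?_ (fun k => ?_) j
  · simp only [bary, Fin.cons_zero]
    fun_prop
  · simp only [bary, Fin.cons_succ]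
    fun_prop

theorem continuous_bern {m n : ℕ} (α : MultiIndex m n) : Continuous (bern α) := by
  unfold bern
  fun_prop

theorem faceMassMatrix_apply_eq_integral {d N : ℕ} (f : Fin (d + 2))
    (α β : MultiIndex (d + 2) N) :
    faceMassMatrix N f α β = ∫ y in refSimplex d,
      bern β (f.insertNth (0 : ℝ) (bary y)) * bern α (f.insertNth (0 : ℝ) (bary y)) := by
  simp only [faceMassMatrix, Matrix.of_apply, faceMeasure]
  rw [integral_map (measurable_faceParam f).aemeasurable]
  · simp only [bary_faceParam]
  · exact (((continuous_bern β).comp continuous_bary).mul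
      ((continuous_bern α).comp continuous_bary)).aestronglyMeasurable

theorem bern_insertNth_zero_of_ne_zero {m n : ℕ} (f : Fin (m + 1)) (α : MultiIndex (m + 1) n)
    (h : α.1 f ≠ 0) (lam : Fin m → ℝ) : bern α (f.insertNth (0 : ℝ) lam) = 0 := by
  unfold bern
  refine mul_eq_zero_of_right _ (Finset.prod_eq_zero (Finset.mem_univ f) ?_)
  simp [h]

theorem bern_faceIndex {m n : ℕ} (f : Fin (m + 1)) (α : MultiIndex m n) (lam : Fin m → ℝ) :
    bern (faceIndex n f α) (f.insertNth (0 : ℝ) lam) = bern α lam := by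
  unfold bern
  rw [Fin.prod_univ_succAbove _ f, Fin.prod_univ_succAbove _ f]
  simp [faceIndex, insertIndex]

theorem faceMassMatrix_eq_zero_right {d N : ℕ} (f : Fin (d + 2)) (α β : MultiIndex (d + 2) N)
    (h : β.1 f ≠ 0) : faceMassMatrix N f α β = 0 := by
  rw [faceMassMatrix_apply_eq_integral]
  simp [bern_insertNth_zero_of_ne_zero f β h]

theorem faceMassMatrix_eq_zero_left {d N : ℕ} (f : Fin (d + 2)) (α β : MultiIndex (d + 2) N)
    (h : α.1 f ≠ 0) : faceMassMatrix N f α β = 0 := by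
  rw [faceMassMatrix_apply_eq_integral]
  simp [bern_insertNth_zero_of_ne_zero f α h]

theorem faceMassMatrix_faceIndex {d N : ℕ} (f : Fin (d + 2)) (α β : MultiIndex (d + 1) N) :
    faceMassMatrix N f (faceIndex N f α) (faceIndex N f β) =
      2 ^ d * (N.factorial : ℝ) ^ 2 / (2 * N + d).factorial * gram α.1 β.1 := by
  rw [faceMassMatrix_apply_eq_integral]
  simp only [bern_faceIndex]
  exact integral_bern_mul_bern d α β

/-! ### Invertibility of the mass matrix -/

/-- By the Vandermonde identity, `gram` is a sum of products. -/
theorem gram_eq_sum {m N : ℕ} (α β : Fin m → ℕ) (hα : ∀ j, α j ≤ N) :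
    gram α β = ∑ π : Fin m → Fin (N + 1),
      (∏ j, ((α j).choose (π j) : ℝ)) * ∏ j, ((β j).choose (π j) : ℝ) := by
  have h : ∀ j, ((α j + β j).choose (α j) : ℝ) =
      ∑ i : Fin (N + 1), ((α j).choose i : ℝ) * ((β j).choose i : ℝ) := by
    intro j
    rw [Fin.sum_univ_eq_sum_range (fun i => ((α j).choose i : ℝ) * ((β j).choose i : ℝ)),
      add_comm, Nat.add_choose_eq, Finset.Nat.sum_antidiagonal_eq_sum_range_succ_mk]
    push_cast
    refine (Finset.sum_congr rfl fun i hi => ?_).trans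
      (Finset.sum_subset (Finset.range_mono (Nat.succ_le_succ (hα j))) fun i _ hi => ?_)
    · rw [Nat.choose_symm (Nat.lt_succ_iff.mp (Finset.mem_range.mp hi)), mul_comm]
    · rw [Nat.choose_eq_zero_of_lt (by simpa using hi), Nat.cast_zero, zero_mul]
  unfold gram
  simp only [h]
  rw [Finset.prod_univ_sum]
  simp only [Fintype.piFinset_univ, Finset.prod_mul_distrib]

theorem MultiIndex.le {m n : ℕ} (α : MultiIndex m n) (j : Fin m) : α.1 j ≤ n :=
  (Finset.single_le_sum (f := α.1) (fun _ _ => Nat.zero_le _) (Finset.mem_univ j)).trans_eq α.2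

theorem prod_choose_of_multiIndex {m n : ℕ} (α π : MultiIndex m n) :
    (∏ j, ((α.1 j).choose (π.1 j) : ℝ)) = if α = π then 1 else 0 := by
  split_ifs with h
  · simp [h]
  · by_contra h0
    apply h
    have h1 : ∀ j ∈ Finset.univ, π.1 j ≤ α.1 j := by
      intro j hj
      by_contra hlt
      refine h0 (Finset.prod_eq_zero hj ?_)
      rw [Nat.choose_eq_zero_of_lt (not_le.mp hlt), Nat.cast_zero]
    have h2 := (Finset.sum_eq_sum_iff_of_le h1).1 (π.2.trans α.2.symm)
    exact Subtype.ext (funext fun j => (h2 j (Finset.mem_univ j)).symm)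

/-- M is a positive multiple of P Pᵀ, and the columns of P indexed by π with |π| = N form an
identity matrix, so Pᵀ v = 0 forces v = 0. -/
theorem isUnit_det_massMatrix (d N : ℕ) : IsUnit (massMatrix d N).det := by
  rw [isUnit_iff_ne_zero, Ne, ← Matrix.exists_mulVec_eq_zero_iff]
  rintro ⟨v, hv0, hv⟩
  apply hv0
  let P : Matrix (MultiIndex (d + 1) N) (Fin (d + 1) → Fin (N + 1)) ℝ :=
    Matrix.of fun α π => ∏ j, ((α.1 j).choose (π j) : ℝ)
  have hM : massMatrix d N =
      (2 ^ d * (N.factorial : ℝ) ^ 2 / (2 * N + d).factorial) • (P * Pᴴ) := by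
    ext α β
    rw [massMatrix_apply, gram_eq_sum α.1 β.1 α.le]
    simp [P, Matrix.mul_apply]
  rw [hM, Matrix.smul_mulVec, smul_eq_zero] at hv
  have hv' := (Matrix.self_mul_conjTranspose_mulVec_eq_zero P v).1
    (hv.resolve_left (by positivity))
  funext π
  have := congrFun hv' fun j => ⟨π.1 j, Nat.lt_succ_of_le (π.le j)⟩
  simpa [Matrix.mulVec, dotProduct, P, prod_choose_of_multiIndex] using this

/-! ### Degree elevation in terms of `lower` and `raise` -/

theorem sum_mul_oneElevation_row {m n : ℕ} (g : (Fin m → ℕ) → ℝ) (α : MultiIndex m (n + 1)) :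
    ∑ γ : MultiIndex m n, g γ.1 * oneElevation m n α γ = lower g α.1 / ((n : ℝ) + 1) := by
  simp only [oneElevation, Matrix.of_apply, Finset.mul_sum, lower]
  rw [Finset.sum_comm, Finset.sum_div]
  refine Finset.sum_congr rfl fun j _ => ?_
  by_cases h : α.1 j = 0
  · rw [h, Nat.cast_zero, zero_mul, zero_div]
    refine Finset.sum_eq_zero fun γ _ => ?_
    rw [if_neg, mul_zero]
    intro h'
    simp [h'] at h
  · have h1 : α.1 = α.1 - Pi.single j 1 + Pi.single j 1 := by
      funext i
      by_cases hi : i = j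
      · subst hi; simp; omega
      · simp [hi]
    have h2 : ∑ i, (α.1 - Pi.single j 1 : Fin m → ℕ) i = n := by
      have h3 := sum_sub_single α.1 j h
      rw [α.2] at h3
      push_cast at h3
      exact_mod_cast h3.trans (add_sub_cancel_right _ _)
    rw [Finset.sum_eq_single ⟨α.1 - Pi.single j 1, h2⟩]
    · rw [if_pos h1]
      have h4 : (((α.1 - Pi.single j 1 : Fin m → ℕ) j : ℕ) : ℝ) + 1 = α.1 j := by
        have := congrFun h1 j
        rw [Pi.add_apply, Pi.single_eq_same] at this
        exact_mod_cast this.symm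
      rw [h4]
      ring
    · intro γ _ hγ
      rw [if_neg, mul_zero]
      intro h'
      refine hγ (Subtype.ext ?_)
      change γ.1 = α.1 - Pi.single j 1
      rw [h', add_tsub_cancel_right]
    · intro h'
      exact absurd (Finset.mem_univ _) h'

theorem sum_mul_oneElevation_col {m n : ℕ} (g : (Fin m → ℕ) → ℝ) (β : MultiIndex m n) :
    ∑ α : MultiIndex m (n + 1), g α.1 * oneElevation m n α β = raise g β.1 / ((n : ℝ) + 1) := by
  simp only [oneElevation, Matrix.of_apply, Finset.mul_sum, raise]
  rw [Finset.sum_comm, Finset.sum_div]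
  refine Finset.sum_congr rfl fun j _ => ?_
  rw [Finset.sum_eq_single
    ⟨β.1 + Pi.single j 1, by simp [Finset.sum_add_distrib, β.2]⟩]
  · rw [if_pos rfl]
    ring
  · intro α _ hα
    rw [if_neg fun h' => hα (Subtype.ext h'), mul_zero]
  · intro h'
    exact absurd (Finset.mem_univ _) h'

theorem sum_mul_elevation_row {m n k : ℕ} (hk : k ≤ n) (g : (Fin m → ℕ) → ℝ)
    (α : MultiIndex m n) :
    ∑ γ : MultiIndex m k, g γ.1 * elevation m n k α γ =
      (k.factorial : ℝ) / n.factorial * lower^[n - k] g α.1 := by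
  obtain rfl | hkn := hk.eq_or_lt
  · have h : (k.factorial : ℝ) ≠ 0 := by positivity
    simp [elevation_self, Matrix.one_apply, h]
  · induction n with
    | zero => omega
    | succ n ih =>
      have hrow : ∀ δ : MultiIndex m n, ∑ γ : MultiIndex m k, g γ.1 * elevation m n k δ γ =
          (k.factorial : ℝ) / n.factorial * lower^[n - k] g δ.1 := by
        intro δ
        obtain rfl | hkn' := (Nat.lt_succ_iff.mp hkn).eq_or_lt
        · have h : (k.factorial : ℝ) ≠ 0 := by positivity
          simp [elevation_self, Matrix.one_apply, h]
        · exact ih (Nat.lt_succ_iff.mp hkn) δ hkn'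
      simp only [elevation, if_neg hkn.ne, Matrix.mul_apply, Finset.mul_sum]
      rw [Finset.sum_comm]
      calc _ = ∑ δ, (k.factorial : ℝ) / n.factorial *
            (lower^[n - k] g δ.1 * oneElevation m n α δ) := by
            refine Finset.sum_congr rfl fun δ _ => ?_
            rw [← mul_assoc, ← hrow, Finset.sum_mul]
            exact Finset.sum_congr rfl fun γ _ => by ring
        _ = _ := by
            rw [← Finset.mul_sum, sum_mul_oneElevation_row,
              show n + 1 - k = n - k + 1 by omega, Function.iterate_succ_apply',
              Nat.factorial_succ]
            push_cast
            field_simp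

theorem elevation_succ_self (m n : ℕ) : elevation m (n + 1) n = oneElevation m n := by
  simp [elevation, elevation_self]

/-- The two elevation factors contribute `lower` and `raise`, each divided by N+1, which cancels
(N+1)². -/
theorem sum_mul_L0 {m N : ℕ} (g : (Fin m → ℕ) → ℝ) (β : MultiIndex m N) :
    ∑ γ : MultiIndex m N, g γ.1 * L0 m N γ β = raise (lower g) β.1 / 2 := by
  simp only [L0, elevation_succ_self, Matrix.smul_apply, Matrix.mul_apply,
    Matrix.transpose_apply, smul_eq_mul, Finset.mul_sum]
  rw [Finset.sum_comm]
  have h : (N : ℝ) + 1 ≠ 0 := by positivity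
  calc _ = ∑ α, ((N : ℝ) + 1) / 2 * (lower g α.1 * oneElevation m N α β) := by
        refine Finset.sum_congr rfl fun α _ => ?_
        have h' := sum_mul_oneElevation_row g α
        rw [eq_div_iff h] at h'
        rw [← h', Finset.sum_mul, Finset.sum_mul, Finset.mul_sum]
        exact Finset.sum_congr rfl fun γ _ => by ring
    _ = _ := by
        rw [← Finset.mul_sum, sum_mul_oneElevation_col]
        field_simp

/-! ### The reduction formula layer by layer -/

theorem gram_insertIndex {m N : ℕ} (f : Fin (m + 1)) (k i : Fin (N + 1))
    (α : MultiIndex m (N - k)) (γ : MultiIndex m (N - i)) :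
    gram (insertIndex f k α).1 (insertIndex f i γ).1 =
      ((k + i : ℕ).choose k : ℝ) * gram α.1 γ.1 := by
  unfold gram
  rw [Fin.prod_univ_succAbove _ f]
  simp [insertIndex]

/-- This is where ℓ_i is explained: binom(N, i)/(1+i) times the elevation factor (N-i)!/N! is
1/(i+1)!. The transposed elevation gives i lowerings, and L_0 supplies one more together with
`raise` / 2. -/
theorem sum_gram_mul_faceReduction {m N : ℕ} (α : Fin m → ℕ) (i : Fin (N + 1))
    (β : MultiIndex m N) :
    ∑ γ : MultiIndex m (N - i), gram α γ.1 * (faceReduction m N * L0 m N) ⟨i, γ⟩ β =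
      (-1) ^ (i : ℕ) / (2 * ((i + 1 : ℕ).factorial : ℝ)) *
        raise (lower^[i + 1] (gram α)) β.1 := by
  have hi : (i : ℕ) ≤ N := Nat.lt_succ_iff.mp i.2
  simp only [Matrix.mul_apply, faceReduction, Matrix.of_apply, Matrix.smul_apply,
    Matrix.transpose_apply, smul_eq_mul, Finset.mul_sum]
  rw [Finset.sum_comm]
  calc _ = ∑ δ, ell N i * (((N - i : ℕ).factorial : ℝ) / N.factorial) *
        (lower^[i] (gram α) δ.1 * L0 m N δ β) := by
        refine Finset.sum_congr rfl fun δ _ => ?_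
        have h := sum_mul_elevation_row (Nat.sub_le N i) (gram α) δ
        rw [Nat.sub_sub_self hi] at h
        rw [← mul_assoc, mul_assoc (ell N i), ← h, Finset.mul_sum, Finset.sum_mul]
        exact Finset.sum_congr rfl fun γ _ => by ring
    _ = _ := by
        rw [← Finset.mul_sum, sum_mul_L0, ← Function.iterate_succ_apply' lower, ell,
          Nat.cast_choose ℝ hi, Nat.factorial_succ]
        have h1 : (N.factorial : ℝ) ≠ 0 := by positivity
        have h2 : ((N - i : ℕ).factorial : ℝ) ≠ 0 := by positivity
        have h3 : ((i : ℕ).factorial : ℝ) ≠ 0 := by positivity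
        have h4 : 1 + ((i : ℕ) : ℝ) ≠ 0 := by positivity
        have h5 : ((i : ℕ) : ℝ) + 1 ≠ 0 := by positivity
        push_cast
        field_simp
        ring

/-- Multiplying the reduction formula by the mass matrix gives the face mass matrix. -/
theorem massMatrix_mul_faceReduction {d N : ℕ} (f : Fin (d + 2)) :
    massMatrix (d + 1) N *
        (faceReduction (d + 1) N * L0 (d + 1) N).submatrix (layers N f).symm id =
      (faceMassMatrix N f).submatrix id (faceIndex N f) := by
  ext α β
  obtain ⟨⟨k, α⟩, rfl⟩ := (layers N f).surjective α
  have hlay : ∀ p, layers N f p = insertIndex f p.1 p.2 := fun _ => rfl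
  have hk : (k : ℕ) ≤ N := Nat.lt_succ_iff.mp k.2
  rw [Matrix.mul_apply, ← (layers N f).sum_comp, Fintype.sum_sigma]
  simp only [Matrix.submatrix_apply, id, Equiv.symm_apply_apply, massMatrix_apply]
  simp only [hlay, gram_insertIndex]
  set c : ℝ := 2 ^ (d + 1) * (N.factorial : ℝ) ^ 2 / (2 * N + (d + 1)).factorial with hc
  calc _ = ∑ i : Fin (N + 1), c / 2 * ((-1 : ℝ) ^ (i : ℕ) * ((k + i : ℕ).choose k : ℝ) /
        ((i + 1 : ℕ).factorial : ℝ) * raise (lower^[i + 1] (gram α.1)) β.1) := by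
        refine Finset.sum_congr rfl fun i _ => ?_
        calc _ = c * ((k + i : ℕ).choose k : ℝ) * ∑ γ : MultiIndex (d + 1) (N - i),
              gram α.1 γ.1 * (faceReduction (d + 1) N * L0 (d + 1) N) ⟨i, γ⟩ β := by
              rw [Finset.mul_sum]
              exact Finset.sum_congr rfl fun γ _ => by ring
          _ = _ := by
              rw [sum_gram_mul_faceReduction]
              field_simp
    _ = c / 2 * if (k : ℕ) = 0 then (2 * N + (d + 1 : ℕ)) * gram α.1 β.1 else 0 := by
        rw [← Finset.mul_sum, Fin.sum_univ_eq_sum_range (fun i => (-1 : ℝ) ^ i *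
          ((k + i).choose k : ℝ) / ((i + 1).factorial : ℝ) *
            raise (lower^[i + 1] (gram α.1)) β.1),
          sum_raise_lower_gram α.1 β.1 β.2 (by rw [α.2]; omega)]
    _ = _ := by
        by_cases h0 : (k : ℕ) = 0
        · obtain rfl : k = 0 := Fin.ext h0
          rw [if_pos h0]
          refine Eq.trans ?_ (faceMassMatrix_faceIndex (N := N) f α β).symm
          -- The factor 2N+d+1 cancels against the factorial of the volume integral, and 1/2 against
          -- its extra power of 2, leaving the face constant.
          rw [hc, show 2 * N + (d + 1) = (2 * N + d) + 1 by ring, Nat.factorial_succ]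
          have h1 : ((2 * N + d : ℕ).factorial : ℝ) ≠ 0 := by positivity
          have h2 : (2 * N + d + 1 : ℝ) ≠ 0 := by positivity
          push_cast
          field_simp
          ring
        · rw [if_neg h0, mul_zero, faceMassMatrix_eq_zero_left]
          simpa [insertIndex] using h0

theorem lift_eq {d N : ℕ} (f : Fin (d + 2)) :
    lift N f = faceReduction (d + 1) N * L0 (d + 1) N := by
  have h : (fullLift N f).submatrix id (faceIndex N f) =
      (faceReduction (d + 1) N * L0 (d + 1) N).submatrix (layers N f).symm id := by
    have hM := congrArg (fun A => (massMatrix (d + 1) N)⁻¹ * A)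
      (massMatrix_mul_faceReduction (N := N) f)
    rw [Matrix.nonsing_inv_mul_cancel_left _ _ (isUnit_det_massMatrix _ _)] at hM
    rw [hM]
    rfl
  ext p β
  have h' := congrFun (congrFun h (layers N f p)) β
  simpa [lift] using h'

theorem fullLift_eq_zero {d N : ℕ} (f : Fin (d + 2)) (α β : MultiIndex (d + 2) N)
    (h : β.1 f ≠ 0) : fullLift N f α β = 0 := by
  rw [fullLift, Matrix.mul_apply]
  exact Finset.sum_eq_zero fun γ _ => by rw [faceMassMatrix_eq_zero_right f γ β h, mul_zero]

theorem liftBlock_eq {d N : ℕ} (f : Fin (d + 2)) (i : Fin (N + 1)) :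
    liftBlock N f i = ell N i • ((elevation (d + 1) N (N - i))ᵀ * L0 (d + 1) N) := by
  ext α β
  rw [liftBlock, lift_eq, ← Matrix.smul_mul]
  rfl

theorem liftBlock_zero {d N : ℕ} (f : Fin (d + 2)) : liftBlock N f 0 = L0 (d + 1) N := by
  ext α β
  rw [liftBlock_eq]
  change ell N 0 * ((elevation (d + 1) N N)ᵀ * L0 (d + 1) N) α β = L0 (d + 1) N α β
  rw [elevation_self, Matrix.transpose_one, Matrix.one_mul]
  simp [ell]

end BernsteinBezier

end

theorem mainTheorem1 (d N : ℕ) (f : Fin (d + 2)) :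
    IsUnit (BernsteinBezier.massMatrix (d + 1) N).det ∧
    (∀ α β : BernsteinBezier.MultiIndex (d + 2) N, β.1 f ≠ 0 →
      BernsteinBezier.fullLift N f α β = 0) ∧
    BernsteinBezier.liftBlock N f 0 = BernsteinBezier.L0 (d + 1) N ∧
    (∀ i : Fin (N + 1), BernsteinBezier.liftBlock N f i =
      BernsteinBezier.ell N i •
        ((BernsteinBezier.elevation (d + 1) N (N - i))ᵀ * BernsteinBezier.L0 (d + 1) N)) ∧
    BernsteinBezier.lift N f =
      BernsteinBezier.faceReduction (d + 1) N * BernsteinBezier.L0 (d + 1) N := by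
  exact ⟨BernsteinBezier.isUnit_det_massMatrix _ _, BernsteinBezier.fullLift_eq_zero f,
    BernsteinBezier.liftBlock_zero f, BernsteinBezier.liftBlock_eq f, BernsteinBezier.lift_eq f⟩
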